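/- For $z\in\mathbb R$ let $\operatorname{erfc}(z)=\frac{2}{\sqrt\pi}\int_z^\infty e^{-t^2}\,dt$, and let $H_m$ be the Hermite polynomials given by $H_0=1$, $H_{m+1}(x)=2xH_m(x)-H_m'(x)$. For $\xi,z\in\mathbb R$ and $m\ge 0$ put $$\varphi_m(z;\xi)=\left(-\tfrac12 i\right)^m H_m(-iz)+\left(-\tfrac12\right)^{m+1}\xi\, e^{-z^2}\frac{d^m}{dz^m}\left\{\operatorname{erfc}(z)\,e^{z^2}\right\},$$ which is a real number, and let $\tau_n(z;\xi)=\det\left[\varphi_{j+k}(z;\xi)\right]_{j,k=0}^{n-1}$ for $n\ge 0$, with $\tau_0=1$. Let $0<\xi<1$. Then for every $n\ge0$ the function $\tau_n(\cdot\,;\xi)$ is differentiable and strictly positive on $\mathbb R$, so that $$\Sigma_n(z;\xi)=\frac{d}{dz}\ln\frac{\tau_{n+1}(z;\xi)}{\tau_n(z;\xi)},\qquad \sigma_n(z;\xi)=\frac{d}{dz}\ln\tau_n(z;\xi)$$ are defined for all real $z$, and: (i) for every $n\ge 0$, $\Sigma_n(\cdot\,;\xi)$ is bounded on $\mathbb R$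 and is positive on $\mathbb R$ except at exactly $n$ distinct points, where it vanishes; (ii) for every $n\ge 1$, $\sigma_n(\cdot\,;\xi)$ is bounded on $\mathbb R$ and $\sigma_n(z;\xi)>0$ for all $z\in\mathbb R$. -/

import Mathlib

noncomputable section

namespace BoundState

/-- The complementary error function `erfc z = (2/√π) ∫_z^∞ exp(-t²) dt`. -/
def erfc (z : ℝ) : ℝ :=
  2 / Real.sqrt Real.pi * ∫ t in Set.Ioi z, Real.exp (-t ^ 2)

/-- The Hermite polynomials `H_m` orthogonal for `exp(-x²)`, given by
`H_0 = 1`, `H_{m+1}(x) = 2 x H_m(x) - H_m'(x)`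
(Mathlib's `Polynomial.hermite` is the family for `exp(-x²/2)`). -/
def hermiteH : ℕ → Polynomial ℂ
  | 0 => 1
  | m + 1 => 2 * Polynomial.X * hermiteH m - Polynomial.derivative (hermiteH m)

/-- `φ_m(z;ξ) = (-i/2)^m H_m(-iz) + (-1/2)^{m+1} ξ exp(-z²) (d/dz)^m {erfc(z) exp(z²)}`,
as a complex number. -/
def phiC (m : ℕ) (ξ z : ℝ) : ℂ :=
  (-(1 / 2 : ℂ) * Complex.I) ^ m * (hermiteH m).eval (-Complex.I * (z : ℂ)) +
    (((-(1 / 2 : ℝ)) ^ (m + 1) * ξ * Real.exp (-z ^ 2) *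
      iteratedDeriv m (fun x : ℝ => erfc x * Real.exp (x ^ 2)) z : ℝ) : ℂ)

/-- `φ_m(z;ξ)` as a real number; no information is lost, see `ofReal_phi`. -/
def phi (m : ℕ) (ξ z : ℝ) : ℝ := (phiC m ξ z).re

theorem hermiteH_eval_neg (m : ℕ) (w : ℂ) :
    (hermiteH m).eval (-w) = (-1) ^ m * (hermiteH m).eval w := by
  have key : ∀ m, (hermiteH m).comp (-Polynomial.X) = (-1) ^ m * hermiteH m := by
    intro m
    induction m with
    | zero => simp [hermiteH]
    | succ m ih =>
      have hd := congrArg Polynomial.derivative ih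
      rw [Polynomial.derivative_comp] at hd
      have h1 : Polynomial.derivative ((-1 : Polynomial ℂ) ^ m * hermiteH m)
          = (-1) ^ m * Polynomial.derivative (hermiteH m) := by
        have : ((-1 : Polynomial ℂ) ^ m) = Polynomial.C ((-1) ^ m) := by simp
        rw [this, Polynomial.derivative_C_mul]
      rw [h1] at hd
      simp only [Polynomial.derivative_neg, Polynomial.derivative_X] at hd
      simp only [hermiteH, Polynomial.sub_comp, Polynomial.mul_comp, Polynomial.X_comp,
        Polynomial.ofNat_comp, ih]
      rw [pow_succ]
      linear_combination hd
  have h := congrArg (Polynomial.eval w) (key m)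
  simpa [Polynomial.eval_comp] using h

theorem hermiteH_eval_conj (m : ℕ) (w : ℂ) :
    (starRingEnd ℂ) ((hermiteH m).eval w) = (hermiteH m).eval ((starRingEnd ℂ) w) := by
  have key : ∀ m, (hermiteH m).map (starRingEnd ℂ) = hermiteH m := by
    intro m
    induction m with
    | zero => simp [hermiteH]
    | succ m ih =>
      simp only [hermiteH, Polynomial.map_sub, Polynomial.map_mul, Polynomial.map_X,
        Polynomial.map_ofNat, ← Polynomial.derivative_map, ih]
  have h := Polynomial.eval_map_apply (p := hermiteH m) (starRingEnd ℂ) w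
  rw [key] at h
  exact h.symm

theorem ofReal_phi (m : ℕ) (ξ z : ℝ) : ((phi m ξ z : ℝ) : ℂ) = phiC m ξ z := by
  apply Complex.conj_eq_iff_re.mp
  unfold phiC
  rw [map_add, Complex.conj_ofReal, map_mul, map_pow, hermiteH_eval_conj]
  congr 1
  have e1 : (starRingEnd ℂ) (-Complex.I * (z : ℂ)) = -(-Complex.I * (z : ℂ)) := by simp
  have e2 : (starRingEnd ℂ) (-(1 / 2 : ℂ) * Complex.I) = (-1) * (-(1 / 2 : ℂ) * Complex.I) := by
    simp [map_ofNat]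
  rw [e1, e2, hermiteH_eval_neg, mul_pow]
  have e3 : ((-1 : ℂ) ^ m) * (-1) ^ m = 1 := by rw [← mul_pow]; simp
  linear_combination ((-(1 / 2 : ℂ) * Complex.I) ^ m *
    (hermiteH m).eval (-Complex.I * (z : ℂ))) * e3

/-- The Hankel determinant `τ_n(z;ξ) = det [φ_{j+k}(z;ξ)]_{j,k=0}^{n-1}` (so `τ_0 = 1`). -/
def tau (n : ℕ) (ξ z : ℝ) : ℝ :=
  (Matrix.of fun j k : Fin n => phi ((j : ℕ) + (k : ℕ)) ξ z).det

/-- `Σ_n(z;ξ) = d/dz ln (τ_{n+1}(z;ξ) / τ_n(z;ξ))`. -/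
def bigSigma (n : ℕ) (ξ z : ℝ) : ℝ :=
  deriv (fun x : ℝ => Real.log (tau (n + 1) ξ x / tau n ξ x)) z

/-- `σ_n(z;ξ) = d/dz ln τ_n(z;ξ)`. -/
def smallSigma (n : ℕ) (ξ z : ℝ) : ℝ :=
  deriv (fun x : ℝ => Real.log (tau n ξ x)) z

end BoundState

end

open Polynomial MeasureTheory Filter Topology

namespace BoundState

/-! The `φ_m(z)` are the moments of the weight `π^{-1/2} exp(-(s+z)²)` damped by the factor `1 - ξ`
on `s > 0` (`momentFunctional_X_pow`). For `ξ < 1` this weight is positive, so the Hankel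
determinants `τ_n` are positive, and `τ_{n+1}/τ_n` is the squared norm of the monic orthogonal
polynomial `Q_n`, the least among monic polynomials of degree `n`. Differentiating this minimum in
`z` (`hasDerivAt_tau_succ_div_tau`) leaves only the contribution of the jump, whence `Σ_n = κ(z)
Q_n(0)² / (τ_{n+1}/τ_n) ≥ 0` with `κ = jumpDensity`.

The zeros of `Σ_n` are thus the `z` at which one of the `n` simple real zeros of `Q_n` sits at the
origin. Each ordered zero is continuous in `z` (`continuous_zeros`) and stays within bounded
distance of `-z` (`exists_zeros_bound`), so it reaches the origin; by Gauss quadrature it does so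
only once (`zero_neg_of_nonpos`). Simplicity makes the `n` crossings distinct.

For boundedness, `Q_n(0)²` grows at most polynomially, `κ` is Gaussian, and the norm is bounded
below. Finally `σ_n = ∑_{k<n} Σ_k`, where `Σ_0 > 0`. -/

/-- The density `π^{-1/2} ξ exp(-z²)` by which the weight grows at the jump as `z` increases. -/
noncomputable def jumpDensity (ξ z : ℝ) : ℝ := (√Real.pi)⁻¹ * ξ * Real.exp (-z ^ 2)

/-- The Gaussian weight centred at `-z`, multiplied by `1 - ξ` on the positive half-line. -/
noncomputable def weight (ξ z s : ℝ) : ℝ :=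
  (√Real.pi)⁻¹ * Real.exp (-(s + z) ^ 2) * (if 0 < s then 1 - ξ else 1)

/-! ### Differential and three-term relations for `φ_m` -/

theorem hasDerivAt_erfc (z : ℝ) :
    HasDerivAt erfc (-(2 / √Real.pi) * Real.exp (-z ^ 2)) z := by
  have hi : Integrable (fun t : ℝ => Real.exp (-t ^ 2)) := by
    simpa using integrable_exp_neg_mul_sq (b := 1) one_pos
  have hc : Continuous (fun t : ℝ => Real.exp (-t ^ 2)) := by fun_prop
  have he : erfc = fun z => 2 / √Real.pi *
      ((∫ t in Set.Ioi (0 : ℝ), Real.exp (-t ^ 2)) - ∫ t in (0 : ℝ)..z, Real.exp (-t ^ 2)) := by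
    funext z
    have := intervalIntegral.integral_interval_add_Ioi (a := 0) (b := z)
      (f := fun t : ℝ => Real.exp (-t ^ 2)) hi.integrableOn hi.integrableOn
    rw [erfc, ← this]
    ring
  rw [he]
  have := ((intervalIntegral.integral_hasDerivAt_right (hi.intervalIntegrable (a := 0) (b := z))
    (hc.stronglyMeasurableAtFilter _ _) hc.continuousAt).const_sub
      (∫ t in Set.Ioi (0 : ℝ), Real.exp (-t ^ 2))).const_mul (2 / √Real.pi)
  convert! this using 1
  ring

theorem contDiff_erfc_mul_exp :
    ContDiff ℝ (⊤ : ℕ∞) (fun x : ℝ => erfc x * Real.exp (x ^ 2)) := by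
  have h : ContDiff ℝ (⊤ : ℕ∞) erfc := by
    rw [contDiff_infty_iff_deriv]
    refine ⟨fun z => (hasDerivAt_erfc z).differentiableAt, ?_⟩
    rw [funext fun z => (hasDerivAt_erfc z).deriv]
    fun_prop
  fun_prop

/-- The recurrence `φ_m' = -2 (φ_{m+1} + z φ_m)`. -/
theorem hasDerivAt_phi (m : ℕ) (ξ z : ℝ) :
    HasDerivAt (phi m ξ) (-2 * (phi (m + 1) ξ z + z * phi m ξ z)) z := by
  have hA : HasDerivAt
      (fun x : ℝ => ((-(1 / 2 : ℂ) * Complex.I) ^ m *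
        (hermiteH m).eval (-Complex.I * (x : ℂ))).re)
      ((-(1 / 2 : ℂ) * Complex.I) ^ m *
        ((derivative (hermiteH m)).eval (-Complex.I * (z : ℂ)) * -Complex.I)).re z := by
    refine HasDerivAt.real_of_complex (e := fun w : ℂ => (-(1 / 2 : ℂ) * Complex.I) ^ m *
        (hermiteH m).eval (-Complex.I * w)) ?_
    refine HasDerivAt.const_mul _ ?_
    have h1 : HasDerivAt (fun w : ℂ => -Complex.I * w) (-Complex.I) (z : ℂ) := by
      simpa using (hasDerivAt_id (z : ℂ)).const_mul (-Complex.I)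
    exact ((hermiteH m).hasDerivAt (-Complex.I * (z : ℂ))).comp (z : ℂ) h1
  have hB : HasDerivAt (iteratedDeriv m fun x : ℝ => erfc x * Real.exp (x ^ 2))
      (iteratedDeriv (m + 1) (fun x : ℝ => erfc x * Real.exp (x ^ 2)) z) z := by
    rw [iteratedDeriv_succ]
    exact ((contDiff_erfc_mul_exp.differentiable_iteratedDeriv m
      (by exact_mod_cast WithTop.coe_lt_top m)) z).hasDerivAt
  have hE : HasDerivAt (fun x : ℝ => Real.exp (-x ^ 2)) (Real.exp (-z ^ 2) * (-(2 * z))) z := by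
    simpa using ((hasDerivAt_pow 2 z).neg).exp
  have hC := ((hE.const_mul ((-(1 / 2 : ℝ)) ^ (m + 1) * ξ)).mul hB)
  have hphi : ∀ k, phi k ξ = fun x : ℝ => ((-(1 / 2 : ℂ) * Complex.I) ^ k *
        (hermiteH k).eval (-Complex.I * (x : ℂ))).re +
      (-(1 / 2 : ℝ)) ^ (k + 1) * ξ * Real.exp (-x ^ 2) *
        iteratedDeriv k (fun x : ℝ => erfc x * Real.exp (x ^ 2)) x := by
    intro k
    funext x
    simp only [phi, phiC, Complex.add_re, Complex.ofReal_re]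
  have hD := hA.add hC
  rw [hphi m, hphi (m + 1)]
  convert! hD using 1
  -- The Hermite recurrence at `-iz`; the factor `-i/2` turns `2(-iz)` into `-z`.
  have key : ((-(1 / 2 : ℂ) * Complex.I) ^ (m + 1) *
        (hermiteH (m + 1)).eval (-Complex.I * (z : ℂ))) =
      -(((z : ℝ) : ℂ) * ((-(1 / 2 : ℂ) * Complex.I) ^ m *
        (hermiteH m).eval (-Complex.I * (z : ℂ)))) - ((1 / 2 : ℝ) : ℂ) *
        ((-(1 / 2 : ℂ) * Complex.I) ^ m *
        ((derivative (hermiteH m)).eval (-Complex.I * (z : ℂ)) * -Complex.I)) := by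
    simp only [hermiteH, eval_sub, eval_mul, eval_X, eval_ofNat, pow_succ]
    push_cast
    linear_combination ((-(1 / 2 : ℂ) * Complex.I) ^ m * z *
      (hermiteH m).eval (-Complex.I * (z : ℂ))) * Complex.I_sq
  simp only [key, Complex.sub_re, Complex.neg_re, Complex.re_ofReal_mul]
  ring

theorem phi_succ (m : ℕ) (ξ z : ℝ) :
    phi (m + 1) ξ z = -z * phi m ξ z - deriv (phi m ξ) z / 2 := by
  rw [(hasDerivAt_phi m ξ z).deriv]; ring

theorem phi_zero (ξ z : ℝ) : phi 0 ξ z = 1 - ξ / 2 * erfc z := by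
  have : Real.exp (-z ^ 2) * Real.exp (z ^ 2) = 1 := by rw [← Real.exp_add]; simp
  simp only [phi, phiC, hermiteH, Complex.add_re, Complex.ofReal_re, iteratedDeriv_zero]
  simp
  linear_combination (-(1 / 2 * ξ * erfc z)) * this

theorem deriv_phi_zero (ξ z : ℝ) : deriv (phi 0 ξ) z = jumpDensity ξ z := by
  rw [show phi 0 ξ = fun z => 1 - ξ / 2 * erfc z from funext (phi_zero ξ)]
  rw [(((hasDerivAt_erfc z).const_mul (ξ / 2)).const_sub 1).deriv, jumpDensity]
  ring

theorem hasDerivAt_jumpDensity (ξ z : ℝ) :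
    HasDerivAt (jumpDensity ξ) (-2 * z * jumpDensity ξ z) z := by
  have hE : HasDerivAt (fun x : ℝ => Real.exp (-x ^ 2)) (Real.exp (-z ^ 2) * (-(2 * z))) z := by
    simpa using ((hasDerivAt_pow 2 z).neg).exp
  convert! hE.const_mul ((√Real.pi)⁻¹ * ξ) using 1
  simp only [jumpDensity]; ring

theorem phi_one (ξ z : ℝ) : phi 1 ξ z = -z * phi 0 ξ z - jumpDensity ξ z / 2 := by
  rw [phi_succ 0, deriv_phi_zero]

/-- The Appell property of the sequence `φ_m`. -/
theorem hasDerivAt_phi_succ (m : ℕ) (ξ z : ℝ) :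
    HasDerivAt (phi (m + 1) ξ) (-(m + 1) * phi m ξ z) z := by
  have h0 : ∀ z, HasDerivAt (phi 0 ξ) (jumpDensity ξ z) z := fun z => by
    have := (hasDerivAt_phi 0 ξ z).differentiableAt.hasDerivAt
    rwa [deriv_phi_zero] at this
  have h1 : ∀ z, HasDerivAt (phi 1 ξ) (-phi 0 ξ z) z := fun z => by
    rw [show phi 1 ξ = fun z => -z * phi 0 ξ z - jumpDensity ξ z / 2 from funext (phi_one ξ)]
    convert! ((hasDerivAt_neg z).fun_mul (h0 z)).sub
      ((hasDerivAt_jumpDensity ξ z).div_const 2) using 1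
    ring
  -- Inserting the Appell property at lower indices into `phi_succ` gives a three-term relation
  -- without derivatives; differentiating it yields the next case.
  induction m using Nat.strong_induction_on generalizing z with
  | _ m ih =>
    match m with
    | 0 => simpa using h1 z
    | 1 =>
      have hr : phi 2 ξ = fun z => -z * phi 1 ξ z + phi 0 ξ z / 2 := by
        funext z
        rw [phi_succ 1, (h1 z).deriv]; ring
      rw [show 1 + 1 = 2 from rfl, hr]
      convert! ((hasDerivAt_neg z).fun_mul (h1 z)).add ((h0 z).div_const 2) using 1
      rw [phi_one]
      push_cast; ring
    | k + 2 =>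
      have hr : ∀ j, j < k + 2 → ∀ z, phi (j + 2) ξ z =
          -z * phi (j + 1) ξ z + (j + 1) / 2 * phi j ξ z := fun j hj z => by
        rw [phi_succ (j + 1), (ih j hj z).deriv]; ring
      rw [show phi (k + 2 + 1) ξ = fun z => -z * phi (k + 2) ξ z + (k + 2) / 2 * phi (k + 1) ξ z
        from funext fun z => by rw [hr (k + 1) (by omega)]; push_cast; ring]
      convert! ((hasDerivAt_neg z).fun_mul (ih (k + 1) (by omega) z)).add
        ((ih k (by omega) z).const_mul ((k + 2) / 2 : ℝ)) using 1
      rw [hr k (by omega)]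
      push_cast; ring

/-- At `m = 0` the truncated index `m - 1` is harmless, its coefficient being zero. -/
theorem hasDerivAt_phi' (m : ℕ) (ξ z : ℝ) :
    HasDerivAt (phi m ξ) (-m * phi (m - 1) ξ z + if m = 0 then jumpDensity ξ z else 0) z := by
  cases m with
  | zero =>
    have := (hasDerivAt_phi 0 ξ z).differentiableAt.hasDerivAt
    rw [deriv_phi_zero] at this
    simpa using this
  | succ m => simpa using hasDerivAt_phi_succ m ξ z

/-- The three-term relation `φ_{m+1} + z φ_m = (m/2) φ_{m-1} - [m = 0] κ / 2`. -/
theorem phi_recurrence (m : ℕ) (ξ z : ℝ) :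
    m * phi (m - 1) ξ z =
      2 * (phi (m + 1) ξ z + z * phi m ξ z) + if m = 0 then jumpDensity ξ z else 0 := by
  have := (hasDerivAt_phi m ξ z).unique (hasDerivAt_phi' m ξ z)
  linarith

/-! ### Moments of the Gaussian weight with a jump -/

theorem integrable_eval_mul_gaussian (p : ℝ[X]) (z : ℝ) :
    Integrable (fun s : ℝ => p.eval s * Real.exp (-(s + z) ^ 2)) := by
  have h : ∀ q : ℝ[X], Integrable (fun s : ℝ => q.eval s * Real.exp (-s ^ 2)) := by
    intro q
    induction q using Polynomial.induction_on' with
    | add p q hp hq => simpa only [eval_add, add_mul] using! hp.add hq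
    | monomial n a =>
      have := (integrable_rpow_mul_exp_neg_mul_sq (b := 1) one_pos (s := n)
        (by linarith [(Nat.cast_nonneg n : (0 : ℝ) ≤ n)])).const_mul a
      simpa [mul_assoc] using this
  have := (h (p.comp (X - C z))).comp_add_right z
  simpa using this

theorem eval_mul_weight_eq (p : ℝ[X]) (ξ z s : ℝ) : p.eval s * weight ξ z s =
    (√Real.pi)⁻¹ * (p.eval s * Real.exp (-(s + z) ^ 2) -
    ξ * (Set.Ioi (0 : ℝ)).indicator (fun s => p.eval s * Real.exp (-(s + z) ^ 2)) s) := by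
  by_cases h : 0 < s <;> simp [weight, h] <;> ring

theorem integrable_eval_mul_weight (p : ℝ[X]) (ξ z : ℝ) :
    Integrable (fun s : ℝ => p.eval s * weight ξ z s) := by
  simp_rw [eval_mul_weight_eq]
  have h := integrable_eval_mul_gaussian p z
  exact (h.sub ((h.indicator measurableSet_Ioi).const_mul ξ)).const_mul _

/-- Integration of polynomials against `weight ξ z`. -/
noncomputable def momentFunctional (ξ z : ℝ) : ℝ[X] →ₗ[ℝ] ℝ where
  toFun p := ∫ s, p.eval s * weight ξ z s
  map_add' p q := by
    simp only [eval_add, add_mul]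
    exact integral_add (integrable_eval_mul_weight p ξ z) (integrable_eval_mul_weight q ξ z)
  map_smul' c p := by
    simp only [eval_smul, smul_eq_mul, mul_assoc, RingHom.id_apply]
    exact integral_const_mul _ _

theorem momentFunctional_apply (ξ z : ℝ) (p : ℝ[X]) :
    momentFunctional ξ z p = ∫ s, p.eval s * weight ξ z s := rfl

theorem momentFunctional_eq (ξ z : ℝ) (p : ℝ[X]) :
    momentFunctional ξ z p = (√Real.pi)⁻¹ * ((∫ s, p.eval s * Real.exp (-(s + z) ^ 2)) -
      ξ * ∫ s in Set.Ioi (0 : ℝ), p.eval s * Real.exp (-(s + z) ^ 2)) := by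
  have h := integrable_eval_mul_gaussian p z
  rw [momentFunctional_apply]
  simp_rw [eval_mul_weight_eq]
  rw [integral_const_mul, integral_sub h ((h.indicator measurableSet_Ioi).const_mul ξ),
    integral_const_mul, integral_indicator measurableSet_Ioi]

/-- Integration by parts for the weight with a jump at the origin. -/
theorem momentFunctional_derivative (ξ z : ℝ) (p : ℝ[X]) :
    momentFunctional ξ z (derivative p) =
      2 * momentFunctional ξ z ((X + C z) * p) + p.eval 0 * jumpDensity ξ z := by
  suffices h : momentFunctional ξ z (derivative p - C 2 * ((X + C z) * p)) =
      p.eval 0 * jumpDensity ξ z by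
    rw [map_sub, ← smul_eq_C_mul, map_smul, smul_eq_mul] at h
    linarith
  have hd : ∀ s : ℝ, HasDerivAt (fun s => p.eval s * Real.exp (-(s + z) ^ 2))
      ((derivative p - C 2 * ((X + C z) * p)).eval s * Real.exp (-(s + z) ^ 2)) s := by
    intro s
    have hE : HasDerivAt (fun x : ℝ => Real.exp (-(x + z) ^ 2))
        (Real.exp (-(s + z) ^ 2) * (-(2 * (s + z)))) s := by
      simpa using ((((hasDerivAt_id s).add_const z).pow 2).neg).exp
    convert! (p.hasDerivAt s).mul hE using 1
    simp; ring
  have hi := integrable_eval_mul_gaussian p z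
  have hi' := integrable_eval_mul_gaussian (derivative p - C 2 * ((X + C z) * p)) z
  -- The integrand is an exact derivative: the whole line contributes `0`, the half-line only the
  -- boundary term at the jump.
  rw [momentFunctional_eq, integral_eq_zero_of_hasDerivAt_of_integrable hd hi' hi,
    integral_Ioi_of_hasDerivAt_of_tendsto' (fun s _ => hd s) hi'.integrableOn
      (tendsto_zero_of_hasDerivAt_of_integrableOn_Ioi (a := 0) (fun s _ => hd s)
        hi'.integrableOn hi.integrableOn), jumpDensity]
  simp; ring

theorem momentFunctional_one (ξ z : ℝ) : momentFunctional ξ z 1 = phi 0 ξ z := by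
  have h1 : ∫ s : ℝ, Real.exp (-(s + z) ^ 2) = √Real.pi := by
    rw [integral_add_right_eq_self (fun s : ℝ => Real.exp (-s ^ 2)) z]
    simpa using integral_gaussian 1
  have h2 : ∫ s in Set.Ioi (0 : ℝ), Real.exp (-(s + z) ^ 2) =
      ∫ s in Set.Ioi z, Real.exp (-s ^ 2) := by
    rw [← integral_indicator measurableSet_Ioi, ← integral_indicator measurableSet_Ioi,
      ← integral_add_right_eq_self ((Set.Ioi z).indicator fun s => Real.exp (-s ^ 2)) z]
    congr 1 with s
    simp [Set.indicator]
  have hp : √Real.pi ≠ 0 := by positivity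
  rw [momentFunctional_eq, phi_zero, erfc]
  simp only [eval_one, one_mul, h1, h2]
  field_simp

/-- Integration by parts against `X ^ k` is the recurrence `phi_recurrence`, so both sequences agree
once they agree at `0`. -/
theorem momentFunctional_X_pow (ξ z : ℝ) (m : ℕ) :
    momentFunctional ξ z (X ^ m) = phi m ξ z := by
  induction m using Nat.strong_induction_on with
  | _ m ih =>
    match m with
    | 0 => simpa using momentFunctional_one ξ z
    | k + 1 =>
      have h := momentFunctional_derivative ξ z (X ^ k)
      rw [derivative_X_pow, add_mul, map_add, ← smul_eq_C_mul, ← smul_eq_C_mul, map_smul,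
        map_smul, ← pow_succ', ih _ (by omega), ih k (by omega)] at h
      have h2 := phi_recurrence k ξ z
      have h3 : ((X : ℝ[X]) ^ k).eval 0 * jumpDensity ξ z =
          if k = 0 then jumpDensity ξ z else 0 := by
        by_cases hk : k = 0 <;> simp [hk]
      rw [h3] at h
      simp only [smul_eq_mul] at h
      linarith

/-- By linearity this reduces to the derivative of `φ_n`, so nothing is differentiated under the
integral sign. -/
theorem hasDerivAt_momentFunctional (ξ z : ℝ) (p : ℝ[X]) :
    HasDerivAt (fun z => momentFunctional ξ z p)
      (-momentFunctional ξ z (derivative p) + p.eval 0 * jumpDensity ξ z) z := by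
  induction p using Polynomial.induction_on' with
  | add p q hp hq =>
    simp only [map_add, eval_add]
    convert! hp.add hq using 1
    ring
  | monomial n a =>
    have h : ∀ w, momentFunctional ξ w (monomial n a) = a * phi n ξ w := fun w => by
      rw [← C_mul_X_pow_eq_monomial, ← smul_eq_C_mul, map_smul, momentFunctional_X_pow,
        smul_eq_mul]
    simp only [h]
    convert! (hasDerivAt_phi' n ξ z).const_mul a using 1
    rw [derivative_monomial, ← C_mul_X_pow_eq_monomial, ← C_mul_X_pow_eq_monomial,
      ← smul_eq_C_mul, map_smul, momentFunctional_X_pow]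
    by_cases hn : n = 0
    · simp [hn]
    · simp [hn]; ring

/-! ### Orthogonal polynomials of a positive functional -/

/-- A linear functional on real polynomials that is positive on nonnegative ones. -/
def PositiveFunctional (L : ℝ[X] →ₗ[ℝ] ℝ) : Prop :=
  ∀ p : ℝ[X], p ≠ 0 → (∀ x, 0 ≤ p.eval x) → 0 < L p

/-- The Hankel matrix of the moments of `L`. -/
noncomputable def hankel (L : ℝ[X] →ₗ[ℝ] ℝ) (n : ℕ) : Matrix (Fin n) (Fin n) ℝ :=
  Matrix.of fun j k => L (X ^ ((j : ℕ) + (k : ℕ)))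

/-- The orthogonal polynomial of degree `n` with leading coefficient `(hankel L n).det`. -/
noncomputable def hankelPoly (L : ℝ[X] →ₗ[ℝ] ℝ) (n : ℕ) : ℝ[X] :=
  ∑ k : Fin (n + 1), C ((hankel L (n + 1)).adjugate k (Fin.last n)) * X ^ (k : ℕ)

/-- The monic orthogonal polynomial of degree `n`. -/
noncomputable def orthoPoly (L : ℝ[X] →ₗ[ℝ] ℝ) (n : ℕ) : ℝ[X] :=
  C (hankel L n).det⁻¹ * hankelPoly L n

/-- `Q` is monic of degree `n` and `L`-orthogonal to all polynomials of lower degree. -/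
structure IsMonicOrthogonal (L : ℝ[X] →ₗ[ℝ] ℝ) (n : ℕ) (Q : ℝ[X]) : Prop where
  monic : Q.Monic
  natDegree : Q.natDegree = n
  orthogonal : ∀ p : ℝ[X], p.degree < n → L (Q * p) = 0

section

variable {L : ℝ[X] →ₗ[ℝ] ℝ} {n : ℕ} {Q : ℝ[X]}

theorem functional_C_mul (c : ℝ) (p : ℝ[X]) : L (C c * p) = c * L p := by
  rw [← smul_eq_C_mul, map_smul, smul_eq_mul]

theorem PositiveFunctional.mul_self_pos (hL : PositiveFunctional L) {p : ℝ[X]} (hp : p ≠ 0) :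
    0 < L (p * p) :=
  hL _ (mul_ne_zero hp hp) fun x => by rw [eval_mul]; exact mul_self_nonneg _

theorem natDegree_hankelPoly_le : (hankelPoly L n).natDegree ≤ n := by
  refine natDegree_sum_le_of_forall_le _ _ fun k _ => ?_
  exact (natDegree_C_mul_X_pow_le _ _).trans (Nat.le_of_lt_succ k.2)

theorem coeff_hankelPoly : (hankelPoly L n).coeff n = (hankel L n).det := by
  rw [hankelPoly, finsetSum_coeff, Finset.sum_eq_single (Fin.last n)]
  · rw [coeff_C_mul_X_pow, Matrix.adjugate_fin_succ_eq_det_submatrix]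
    simp only [Fin.val_last, if_true, Fin.succAbove_last]
    rw [← two_mul, pow_mul]
    simp [hankel, Matrix.submatrix]
  · intro k _ hk
    rw [coeff_C_mul_X_pow, if_neg]
    intro h
    exact hk (Fin.ext h.symm)
  · simp

/-- The coefficients form the last column of the adjugate, so these values are the last column of `H
* adj H = det H • 1`. -/
theorem functional_hankelPoly_mul_X_pow {j : ℕ} (hj : j ≤ n) :
    L (hankelPoly L n * X ^ j) = if j = n then (hankel L (n + 1)).det else 0 := by
  have h := congrFun (congrFun (Matrix.mul_adjugate (hankel L (n + 1))) ⟨j, by omega⟩) (Fin.last n)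
  have h2 : L (hankelPoly L n * X ^ j) =
      (hankel L (n + 1) * (hankel L (n + 1)).adjugate) ⟨j, by omega⟩ (Fin.last n) := by
    rw [hankelPoly, Finset.sum_mul, map_sum, Matrix.mul_apply]
    refine Finset.sum_congr rfl fun k _ => ?_
    rw [mul_assoc, ← pow_add, functional_C_mul, hankel, Matrix.of_apply, mul_comm, add_comm j]
  rw [h2, h]
  by_cases hjn : j = n <;> simp [Matrix.one_apply, Fin.ext_iff, hjn]

theorem functional_hankelPoly_mul {p : ℝ[X]} (hp : p.natDegree ≤ n) :
    L (hankelPoly L n * p) = p.coeff n * (hankel L (n + 1)).det := by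
  conv_lhs => rw [as_sum_range_C_mul_X_pow' p (Nat.lt_succ_of_le hp)]
  rw [Finset.mul_sum, map_sum, Finset.sum_eq_single n]
  · rw [mul_left_comm, functional_C_mul, functional_hankelPoly_mul_X_pow le_rfl, if_pos rfl]
  · intro j hj hjn
    rw [mul_left_comm, functional_C_mul,
      functional_hankelPoly_mul_X_pow (Nat.le_of_lt_succ (Finset.mem_range.1 hj)), if_neg hjn,
      mul_zero]
  · simp

/-- `L` of the square of `hankelPoly L n` is the product of the determinants of orders `n` and `n +
1`. -/
theorem PositiveFunctional.det_hankel_pos (hL : PositiveFunctional L) (n : ℕ) :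
    0 < (hankel L n).det := by
  induction n with
  | zero => simp
  | succ n ih =>
    have h0 : hankelPoly L n ≠ 0 := fun h => by
      have := coeff_hankelPoly (L := L) (n := n)
      rw [h, coeff_zero] at this
      exact ih.ne this
    have h := hL.mul_self_pos h0
    rw [functional_hankelPoly_mul natDegree_hankelPoly_le, coeff_hankelPoly] at h
    exact (pos_iff_pos_of_mul_pos h).1 ih

theorem PositiveFunctional.isMonicOrthogonal (hL : PositiveFunctional L) (n : ℕ) :
    IsMonicOrthogonal L n (orthoPoly L n) := by
  have hd := hL.det_hankel_pos n
  have hdeg : (orthoPoly L n).natDegree ≤ n :=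
    (natDegree_C_mul_le _ _).trans natDegree_hankelPoly_le
  have hc : (orthoPoly L n).coeff n = 1 := by
    rw [orthoPoly, coeff_C_mul, coeff_hankelPoly, inv_mul_cancel₀ hd.ne']
  refine ⟨monic_of_natDegree_le_of_coeff_eq_one n hdeg hc, ?_, fun p hp => ?_⟩
  · exact le_antisymm hdeg (le_natDegree_of_ne_zero (by rw [hc]; exact one_ne_zero))
  · rw [orthoPoly, mul_assoc, functional_C_mul,
      functional_hankelPoly_mul (natDegree_le_of_degree_le hp.le), coeff_eq_zero_of_degree_lt hp]
    simp

theorem PositiveFunctional.functional_orthoPoly_sq (hL : PositiveFunctional L) (n : ℕ) :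
    L (orthoPoly L n * orthoPoly L n) = (hankel L (n + 1)).det / (hankel L n).det := by
  have h := hL.isMonicOrthogonal n
  have hc : (orthoPoly L n).coeff n = 1 := by
    have := h.monic.coeff_natDegree
    rwa [h.natDegree] at this
  conv_lhs => rw [orthoPoly, mul_assoc, functional_C_mul, ← orthoPoly]
  rw [functional_hankelPoly_mul h.natDegree.le, hc]
  ring

namespace IsMonicOrthogonal

/-- The monic orthogonal polynomial has the least norm among the monic ones. -/
theorem sq_le_of_monic (hL : PositiveFunctional L) (h : IsMonicOrthogonal L n Q) {p : ℝ[X]}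
    (hp : p.Monic) (hpn : p.natDegree = n) : L (Q * Q) ≤ L (p * p) := by
  have hlt : (p - Q).degree < n := by
    have := degree_sub_lt_left (p := p) (q := Q)
      (by rw [degree_eq_natDegree hp.ne_zero, degree_eq_natDegree h.monic.ne_zero, hpn,
        h.natDegree]) hp.ne_zero (by rw [hp.leadingCoeff, h.monic.leadingCoeff])
    rwa [degree_eq_natDegree hp.ne_zero, hpn] at this
  have h1 := h.orthogonal _ hlt
  have e : p * p = Q * Q + C 2 * (Q * (p - Q)) + (p - Q) * (p - Q) := by
    rw [show (C 2 : ℝ[X]) = 2 from rfl]; ring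
  rw [e, map_add, map_add, functional_C_mul, h1]
  by_cases h0 : p - Q = 0
  · simp [h0]
  · linarith [hL.mul_self_pos h0]

/-- If `Q = w g`, then `L (Q g) = L (w g²)` would be both zero and positive. Applied to `w = |x -
a|²` with `a` nonreal and to `w = (x - a)²`, this makes the zeros real and simple. -/
theorem not_isRoot_of_dvd_sq (hL : PositiveFunctional L) (h : IsMonicOrthogonal L n Q) {w : ℝ[X]}
    (hw : 0 < w.natDegree) (hw0 : ∀ x, 0 ≤ w.eval x) : ¬ w ∣ Q := by
  rintro ⟨g, rfl⟩
  have hne := h.monic.ne_zero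
  have hw' : w ≠ 0 := left_ne_zero_of_mul hne
  have hg : g ≠ 0 := right_ne_zero_of_mul hne
  have hn := h.natDegree
  rw [natDegree_mul hw' hg] at hn
  have h1 := h.orthogonal g (by rw [degree_eq_natDegree hg]; exact_mod_cast (by omega))
  refine (hL (w * g * g) (mul_ne_zero hne hg) fun x => ?_).ne' h1
  rw [mul_assoc, eval_mul, eval_mul]
  exact mul_nonneg (hw0 x) (mul_self_nonneg _)

theorem splits (hL : PositiveFunctional L) (h : IsMonicOrthogonal L n Q) : Q.Splits := by
  refine Splits.of_splits_map (algebraMap ℝ ℂ) (IsAlgClosed.splits _) fun a ha => ?_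
  by_cases him : a.im = 0
  · exact ⟨a.re, Complex.ext (by simp) (by simp [him])⟩
  · exfalso
    rw [mem_roots_map h.monic.ne_zero] at ha
    have hd := Q.quadratic_dvd_of_aeval_eq_zero_im_ne_zero (z := a)
      (by rwa [aeval_def]) him
    refine h.not_isRoot_of_dvd_sq hL ?_ (fun x => ?_) hd
    · have : (X ^ 2 - C (2 * a.re) * X + C (‖a‖ ^ 2) : ℝ[X]).natDegree = 2 := by compute_degree!
      omega
    · simp only [eval_add, eval_sub, eval_mul, eval_pow, eval_X, eval_C]
      rw [Complex.sq_norm, Complex.normSq_apply]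
      nlinarith [sq_nonneg (x - a.re), sq_nonneg a.im]

theorem nodup_roots (hL : PositiveFunctional L) (h : IsMonicOrthogonal L n Q) :
    Q.roots.Nodup := by
  rw [Multiset.nodup_iff_count_le_one]
  intro a
  rw [count_roots]
  by_contra! hc
  refine h.not_isRoot_of_dvd_sq hL (w := (X - C a) ^ 2) ?_ (fun x => ?_)
    ((le_rootMultiplicity_iff h.monic.ne_zero).1 hc)
  · rw [natDegree_pow, natDegree_X_sub_C]; norm_num
  · rw [eval_pow]; exact sq_nonneg _

/-- An orthogonal polynomial has as many distinct real zeros as its degree. -/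
theorem exists_strictMono_zeros (hL : PositiveFunctional L) (h : IsMonicOrthogonal L n Q) :
    ∃ y : Fin n → ℝ, StrictMono y ∧ Q = Lagrange.nodal Finset.univ y := by
  have hnd := h.nodup_roots hL
  have hcard : Q.roots.toFinset.card = n := by
    rw [Multiset.toFinset_card_of_nodup hnd, ← (h.splits hL).natDegree_eq_card_roots, h.natDegree]
  refine ⟨Q.roots.toFinset.orderEmbOfFin hcard, OrderEmbedding.strictMono _, ?_⟩
  have h2 := Finset.prod_map Finset.univ (Q.roots.toFinset.orderEmbOfFin hcard).toEmbedding
    (fun a : ℝ => X - C a)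
  rw [Finset.map_orderEmbOfFin_univ, Finset.prod, Multiset.toFinset_val, hnd.dedup,
    ← (h.splits hL).eq_prod_roots_of_monic h.monic] at h2
  exact h2

/-- Gauss quadrature. -/
theorem quadrature (h : IsMonicOrthogonal L n Q) {y : Fin n → ℝ}
    (hy : Function.Injective y) (hQ : Q = Lagrange.nodal Finset.univ y) {r : ℝ[X]}
    (hr : r.degree < (2 * n : ℕ)) :
    L r = ∑ i, r.eval (y i) * L (Lagrange.basis Finset.univ y i) := by
  have hmod : (r %ₘ Q).degree < (Finset.univ : Finset (Fin n)).card := by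
    have := degree_modByMonic_lt r h.monic
    rw [degree_eq_natDegree h.monic.ne_zero, h.natDegree] at this
    simpa using this
  have hdiv : (r /ₘ Q).degree < n := by
    by_cases h0 : r /ₘ Q = 0
    · simp [h0]
    have h1 := degree_add_divByMonic h.monic
      (not_lt.1 fun hlt => h0 ((divByMonic_eq_zero_iff h.monic).2 hlt))
    rw [← h1, degree_eq_natDegree h.monic.ne_zero, h.natDegree, degree_eq_natDegree h0] at hr
    rw [degree_eq_natDegree h0]
    norm_cast at hr ⊢
    omega
  -- The quotient by `Q` is killed by orthogonality; the remainder equals its interpolant at the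
  -- zeros.
  have h1 := modByMonic_add_div r Q
  have h2 := Lagrange.eq_interpolate (v := y) (hy.injOn) hmod
  have h3 : ∀ i, (r %ₘ Q).eval (y i) = r.eval (y i) := fun i => by
    conv_rhs => rw [← h1]
    rw [eval_add, eval_mul, hQ, Lagrange.eval_nodal_at_node (Finset.mem_univ i)]
    ring
  conv_lhs => rw [← h1, map_add, h.orthogonal _ hdiv, add_zero, h2]
  rw [Lagrange.interpolate_apply, map_sum]
  refine Finset.sum_congr rfl fun i _ => ?_
  rw [functional_C_mul, h3]

/-- Quadrature is exact on the square of a Lagrange basis polynomial, of degree `2n - 2`, and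
returns the weight itself. -/
theorem quadrature_weight_pos (hL : PositiveFunctional L) (h : IsMonicOrthogonal L n Q)
    {y : Fin n → ℝ} (hy : Function.Injective y) (hQ : Q = Lagrange.nodal Finset.univ y)
    (i : Fin n) : 0 < L (Lagrange.basis Finset.univ y i) := by
  have hb := Lagrange.basis_ne_zero (s := Finset.univ) hy.injOn (Finset.mem_univ i)
  have hd : (Lagrange.basis Finset.univ y i * Lagrange.basis Finset.univ y i).degree
      < (2 * n : ℕ) := by
    rw [degree_mul, Lagrange.degree_basis hy.injOn (Finset.mem_univ i)]
    norm_cast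
    have := i.pos
    simp only [Finset.card_univ, Fintype.card_fin]
    omega
  have h1 := hL.mul_self_pos hb
  rw [h.quadrature hy hQ hd, Finset.sum_eq_single i] at h1
  · simpa [Lagrange.eval_basis_self hy.injOn (Finset.mem_univ i)] using h1
  · intro j _ hj
    rw [eval_mul, Lagrange.eval_basis_of_ne hj.symm (Finset.mem_univ j)]
    ring
  · simp

theorem functional_nonneg_of_eval_nonneg (hL : PositiveFunctional L)
    (h : IsMonicOrthogonal L n Q) {y : Fin n → ℝ} (hy : Function.Injective y)
    (hQ : Q = Lagrange.nodal Finset.univ y) {r : ℝ[X]} (hr : r.degree < (2 * n : ℕ))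
    (hr0 : ∀ i, 0 ≤ r.eval (y i)) : 0 ≤ L r := by
  rw [h.quadrature hy hQ hr]
  exact Finset.sum_nonneg fun i _ => mul_nonneg (hr0 i) (h.quadrature_weight_pos hL hy hQ i).le

end IsMonicOrthogonal

end

/-! ### Positivity of `τ_n` and the formula for `Σ_n` -/

theorem tau_eq_det_hankel (n : ℕ) (ξ z : ℝ) :
    tau n ξ z = (hankel (momentFunctional ξ z) n).det := by
  simp only [tau, hankel, momentFunctional_X_pow]

theorem differentiable_tau (n : ℕ) (ξ : ℝ) : Differentiable ℝ (fun z => tau n ξ z) := by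
  have h : ∀ m, Differentiable ℝ (phi m ξ) := fun m z => (hasDerivAt_phi m ξ z).differentiableAt
  simp only [tau, Matrix.det_apply, Matrix.of_apply]
  fun_prop

/-- A nonnegative integrable function with finitely many zeros has positive integral. -/
theorem integral_pos_of_finite_zeros {f : ℝ → ℝ} (hf : Integrable f) (h0 : ∀ s, 0 ≤ f s)
    {S : Set ℝ} (hS : S.Finite) (hfS : ∀ s, f s = 0 → s ∈ S) : 0 < ∫ s, f s := by
  rw [integral_pos_iff_support_of_nonneg h0 hf]
  have h1 : Sᶜ ⊆ Function.support f := fun s hs h => hs (hfS s h)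
  refine lt_of_lt_of_le ?_ (measure_mono h1)
  rw [measure_compl hS.measurableSet (by simp [hS.measure_zero]), hS.measure_zero]
  simp

theorem finite_zeros_of_ne_zero {p : ℝ[X]} (hp : p ≠ 0) : {s : ℝ | p.eval s = 0}.Finite :=
  p.finite_setOfPred_isRoot hp

section

variable {ξ : ℝ}

theorem weight_pos (hξ1 : ξ < 1) (z s : ℝ) : 0 < weight ξ z s := by
  rw [weight]
  have : (0 : ℝ) < if 0 < s then 1 - ξ else 1 := by split_ifs <;> linarith
  positivity

theorem positiveFunctional_momentFunctional (hξ1 : ξ < 1) (z : ℝ) :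
    PositiveFunctional (momentFunctional ξ z) := fun p hp h0 => by
  refine integral_pos_of_finite_zeros (integrable_eval_mul_weight p ξ z)
    (fun s => mul_nonneg (h0 s) (weight_pos hξ1 z s).le) (finite_zeros_of_ne_zero hp) ?_
  exact fun s hs => (mul_eq_zero.1 hs).resolve_right (weight_pos hξ1 z s).ne'

/-- Up to the constant `exp(z² - z'²)`, passing from `z` to `z'` multiplies the weight by
`exp(-2s(z' - z))`, which is below `1` for `s > 0` and above `1` for `s < 0`; both effects lower the
integral of `s p²`. -/
theorem momentFunctional_X_mul_sq_neg (hξ1 : ξ < 1) {z z' : ℝ} (hz : z < z') {p : ℝ[X]}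
    (hp : p ≠ 0) (h : momentFunctional ξ z (X * (p * p)) ≤ 0) :
    momentFunctional ξ z' (X * (p * p)) < 0 := by
  have hw : ∀ s, weight ξ z' s =
      Real.exp (z ^ 2 - z' ^ 2) * Real.exp (-(2 * s * (z' - z))) * weight ξ z s := fun s => by
    have : Real.exp (-(s + z') ^ 2) = Real.exp (z ^ 2 - z' ^ 2) *
        Real.exp (-(2 * s * (z' - z))) * Real.exp (-(s + z) ^ 2) := by
      rw [← Real.exp_add, ← Real.exp_add]; congr 1; ring
    rw [weight, this, weight]; ring
  have hs : ∀ s : ℝ, 0 ≤ s * (1 - Real.exp (-(2 * s * (z' - z)))) := fun s => by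
    rcases le_total 0 s with h | h
    · refine mul_nonneg h (sub_nonneg.2 (Real.exp_le_one_iff.2 ?_))
      nlinarith
    · refine mul_nonneg_of_nonpos_of_nonpos h (sub_nonpos.2 (Real.one_le_exp ?_))
      nlinarith
  have key : 0 < ∫ s, (Real.exp (z ^ 2 - z' ^ 2) * ((X * (p * p)).eval s * weight ξ z s) -
      (X * (p * p)).eval s * weight ξ z' s) := by
    have he : ∀ s, Real.exp (z ^ 2 - z' ^ 2) * ((X * (p * p)).eval s * weight ξ z s) -
        (X * (p * p)).eval s * weight ξ z' s = (s * (1 - Real.exp (-(2 * s * (z' - z))))) *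
        (Real.exp (z ^ 2 - z' ^ 2) * (p.eval s * p.eval s) * weight ξ z s) := fun s => by
      rw [hw]; simp only [eval_mul, eval_X]; ring
    refine integral_pos_of_finite_zeros (((integrable_eval_mul_weight _ ξ z).const_mul _).sub
      (integrable_eval_mul_weight _ ξ z')) (fun s => ?_)
      ((finite_zeros_of_ne_zero hp).union (Set.finite_singleton 0)) (fun s h0 => ?_)
    · rw [he]
      exact mul_nonneg (hs s) (mul_nonneg (mul_nonneg (Real.exp_pos _).le (mul_self_nonneg _))
        (weight_pos hξ1 z s).le)
    · rw [he] at h0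
      rcases mul_eq_zero.1 h0 with h1 | h1
      · right
        rcases mul_eq_zero.1 h1 with h2 | h2
        · exact h2
        · have h3 : Real.exp (-(2 * s * (z' - z))) = 1 := by linarith
          rw [Real.exp_eq_one_iff] at h3
          have h4 : s * (z' - z) = 0 := by linarith
          exact (mul_eq_zero.1 h4).resolve_right (sub_ne_zero.2 hz.ne')
      · left
        have h2 := (mul_eq_zero.1 h1).resolve_right (weight_pos hξ1 z s).ne'
        have h3 := (mul_eq_zero.1 h2).resolve_left (Real.exp_pos _).ne'
        exact mul_self_eq_zero.1 h3
  rw [integral_sub ((integrable_eval_mul_weight _ ξ z).const_mul _)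
    (integrable_eval_mul_weight _ ξ z'), integral_const_mul, ← momentFunctional_apply,
    ← momentFunctional_apply] at key
  have := mul_nonpos_of_nonneg_of_nonpos (Real.exp_pos (z ^ 2 - z' ^ 2)).le h
  linarith

theorem tau_pos (hξ1 : ξ < 1) (n : ℕ) (z : ℝ) : 0 < tau n ξ z := by
  rw [tau_eq_det_hankel]
  exact (positiveFunctional_momentFunctional hξ1 z).det_hankel_pos n

theorem tau_succ_div_tau (hξ1 : ξ < 1) (n : ℕ) (z : ℝ) :
    tau (n + 1) ξ z / tau n ξ z = momentFunctional ξ z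
      (orthoPoly (momentFunctional ξ z) n * orthoPoly (momentFunctional ξ z) n) := by
  rw [(positiveFunctional_momentFunctional hξ1 z).functional_orthoPoly_sq,
    tau_eq_det_hankel, tau_eq_det_hankel]

/-- Envelope argument: with `Q` frozen at `z`, its squared norm dominates the minimum for every
parameter and equals it at `z`, so the derivatives agree there. The term in `(Q²)'` vanishes by
orthogonality. -/
theorem hasDerivAt_tau_succ_div_tau (hξ1 : ξ < 1) (n : ℕ) (z : ℝ) :
    HasDerivAt (fun z => tau (n + 1) ξ z / tau n ξ z)
      (jumpDensity ξ z * (orthoPoly (momentFunctional ξ z) n).eval 0 ^ 2) z := by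
  have hQ := (positiveFunctional_momentFunctional hξ1 z).isMonicOrthogonal n
  set Q := orthoPoly (momentFunctional ξ z) n with hQdef
  have h1 := hasDerivAt_momentFunctional ξ z (Q * Q)
  have h2 : momentFunctional ξ z (derivative (Q * Q)) = 0 := by
    have hd : (derivative Q).degree < n := by
      have := degree_derivative_lt hQ.monic.ne_zero
      rwa [degree_eq_natDegree hQ.monic.ne_zero, hQ.natDegree] at this
    rw [derivative_mul, map_add, mul_comm (derivative Q), hQ.orthogonal _ hd, add_zero]
  have h3 := (((differentiable_tau (n + 1) ξ) z).div ((differentiable_tau n ξ) z)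
    (tau_pos hξ1 n z).ne').hasDerivAt
  have h4 : IsLocalMin (fun w => momentFunctional ξ w (Q * Q) - tau (n + 1) ξ w / tau n ξ w) z := by
    refine Eventually.of_forall fun w => ?_
    have hw := (positiveFunctional_momentFunctional hξ1 w).isMonicOrthogonal n
    have := hw.sq_le_of_monic (positiveFunctional_momentFunctional hξ1 w) hQ.monic hQ.natDegree
    simp only [tau_succ_div_tau hξ1, ← hQdef]
    linarith
  have h5 := h4.hasDerivAt_eq_zero (h1.sub h3)
  rw [h2, eval_mul] at h5
  convert! h3 using 1
  linarith

theorem bigSigma_eq (hξ1 : ξ < 1) (n : ℕ) (z : ℝ) :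
    bigSigma n ξ z = jumpDensity ξ z * (orthoPoly (momentFunctional ξ z) n).eval 0 ^ 2 /
      (tau (n + 1) ξ z / tau n ξ z) :=
  ((hasDerivAt_tau_succ_div_tau hξ1 n z).log
    (div_pos (tau_pos hξ1 (n + 1) z) (tau_pos hξ1 n z)).ne').deriv

theorem smallSigma_succ (hξ1 : ξ < 1) (n : ℕ) (z : ℝ) :
    smallSigma (n + 1) ξ z = smallSigma n ξ z + bigSigma n ξ z := by
  have hd := differentiable_tau n ξ z
  have h1 := tau_pos hξ1 n z
  have h : (fun x => Real.log (tau (n + 1) ξ x)) =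
      (fun x => Real.log (tau n ξ x) + Real.log (tau (n + 1) ξ x / tau n ξ x)) := by
    funext x
    rw [Real.log_div (tau_pos hξ1 (n + 1) x).ne' (tau_pos hξ1 n x).ne']
    ring
  rw [smallSigma, h]
  exact deriv_fun_add (hd.log h1.ne') ((hasDerivAt_tau_succ_div_tau hξ1 n z).log
    (div_pos (tau_pos hξ1 (n + 1) z) h1).ne').differentiableAt

theorem smallSigma_zero (ξ z : ℝ) : smallSigma 0 ξ z = 0 := by
  simp [smallSigma, tau]

theorem smallSigma_eq_sum (hξ1 : ξ < 1) (n : ℕ) (z : ℝ) :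
    smallSigma n ξ z = ∑ k ∈ Finset.range n, bigSigma k ξ z := by
  induction n with
  | zero => simp [smallSigma_zero]
  | succ n ih => rw [smallSigma_succ hξ1, ih, Finset.sum_range_succ]

theorem continuous_eval_orthoPoly (hξ1 : ξ < 1) (n : ℕ) (x : ℝ) :
    Continuous fun z => (orthoPoly (momentFunctional ξ z) n).eval x := by
  have hphi : ∀ m, Continuous fun z => phi m ξ z := fun m =>
    continuous_iff_continuousAt.2 fun z => (hasDerivAt_phi m ξ z).continuousAt
  have hH : ∀ m, Continuous fun z => hankel (momentFunctional ξ z) m := fun m => by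
    simp only [hankel, momentFunctional_X_pow]
    exact continuous_matrix fun i j => hphi _
  simp only [orthoPoly, hankelPoly, eval_mul, eval_C, eval_finsetSum, eval_pow, eval_X]
  refine ((hH n).matrix_det.inv₀ fun z => ?_).mul (continuous_finsetSum _ fun k _ => ?_)
  · exact ((positiveFunctional_momentFunctional hξ1 z).det_hankel_pos n).ne'
  · exact ((hH (n + 1)).matrix_adjugate.matrix_elem _ _).mul continuous_const

end

/-! ### Continuity of zeros and compactness of quadratic forms -/

/-- The ordered zeros of a family of monic polynomials with simple real zeros depend continuously
on the parameter. -/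
theorem continuous_zeros {n : ℕ} {Q : ℝ → ℝ[X]} (hQc : ∀ x, Continuous fun z => (Q z).eval x)
    {y : ℝ → Fin n → ℝ} (hy : ∀ z, StrictMono (y z))
    (hQ : ∀ z, Q z = Lagrange.nodal Finset.univ (y z)) (i : Fin n) :
    Continuous fun z => y z i := by
  refine continuous_iff_continuousAt.2 fun z₀ => Metric.continuousAt_iff'.2 fun ε hε => ?_
  obtain ⟨δ, hδ, hδε, hsep⟩ : ∃ δ > 0, δ < ε ∧
      ∀ j k : Fin n, j < k → y z₀ j + δ < y z₀ k - δ := by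
    have h1 : ∀ᶠ δ in 𝓝[>] (0 : ℝ), ∀ j k : Fin n, j < k → y z₀ j + δ < y z₀ k - δ := by
      refine nhdsWithin_le_nhds (eventually_all.2 fun j => eventually_all.2 fun k => ?_)
      by_cases hjk : j < k
      · have h2 := hy z₀ hjk
        filter_upwards [gt_mem_nhds (show (0 : ℝ) < (y z₀ k - y z₀ j) / 2 by linarith)] with δ hδ _
        linarith
      · exact Eventually.of_forall fun _ h => absurd h hjk
    obtain ⟨δ, ⟨h1, h2⟩, h3⟩ := ((h1.and (nhdsWithin_le_nhds (gt_mem_nhds hε))).and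
      self_mem_nhdsWithin).exists
    exact ⟨δ, h3, h2, h1⟩
  -- The intervals of radius `δ` about the zeros are disjoint, so only the `j`-th factor changes
  -- sign across the `j`-th one.
  have hneg : ∀ j, (Q z₀).eval (y z₀ j - δ) * (Q z₀).eval (y z₀ j + δ) < 0 := by
    intro j
    rw [hQ, Lagrange.eval_nodal, Lagrange.eval_nodal, ← Finset.prod_mul_distrib,
      ← Finset.mul_prod_erase _ _ (Finset.mem_univ j)]
    refine mul_neg_of_neg_of_pos (by nlinarith) (Finset.prod_pos fun k hk => ?_)
    rcases lt_or_gt_of_ne (Finset.ne_of_mem_erase hk) with h | h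
    · have := hsep _ _ h
      exact mul_pos (by linarith) (by linarith)
    · have := hsep _ _ h
      exact mul_pos_of_neg_of_neg (by linarith) (by linarith)
  have hev : ∀ᶠ z in 𝓝 z₀, ∀ j, (Q z).eval (y z₀ j - δ) * (Q z).eval (y z₀ j + δ) < 0 :=
    eventually_all.2 fun j =>
      (((hQc _).mul (hQc _)).continuousAt (x := z₀)).eventually_lt continuousAt_const (hneg j)
  filter_upwards [hev] with z hz
  have hroot : ∀ j, ∃ k, y z k ∈ Set.Icc (y z₀ j - δ) (y z₀ j + δ) := by
    intro j
    have h1 : (0 : ℝ) ∈ Set.uIcc ((Q z).eval (y z₀ j - δ)) ((Q z).eval (y z₀ j + δ)) := by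
      rw [Set.mem_uIcc]
      rcases mul_neg_iff.1 (hz j) with h | h
      · exact Or.inr ⟨h.2.le, h.1.le⟩
      · exact Or.inl ⟨h.1.le, h.2.le⟩
    obtain ⟨w, hw, hw0⟩ := intermediate_value_uIcc (Q z).continuous.continuousOn h1
    rw [Set.uIcc_of_le (by linarith)] at hw
    simp only [hQ, Lagrange.eval_nodal, Finset.prod_eq_zero_iff] at hw0
    obtain ⟨k, _, hk⟩ := hw0
    exact ⟨k, by rwa [← sub_eq_zero.1 hk]⟩
  choose σ hσ using hroot
  have hmono : StrictMono σ := fun j k hjk => by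
    have := hsep j k hjk
    exact (hy z).lt_iff_lt.1 (by linarith [(hσ j).2, (hσ k).1])
  -- A strictly increasing self-map of `Fin n` is the identity, so the nearby zeros carry the same
  -- indices.
  have hid : σ = id := StrictMono.range_inj hmono strictMono_id |>.1 (by
    rw [(Finite.surjective_of_injective hmono.injective).range_eq, Set.range_id])
  have := hσ i
  rw [hid, id] at this
  rw [Real.dist_eq]
  exact lt_of_le_of_lt (abs_le.2 ⟨by linarith [this.1], by linarith [this.2]⟩) hδε

/-- On polynomials of bounded degree, quadratic forms are dominated by a positive functional. -/
theorem PositiveFunctional.exists_bound {L : ℝ[X] →ₗ[ℝ] ℝ} (hL : PositiveFunctional L) (r : ℝ[X])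
    (n : ℕ) : ∃ K : ℝ, ∀ p : ℝ[X], p.natDegree ≤ n → L (r * (p * p)) ≤ K * L (p * p) := by
  let P : (Fin (n + 1) → ℝ) → ℝ[X] := fun c => ∑ i, C (c i) * X ^ (i : ℕ)
  have hcoeff : ∀ c (i : Fin (n + 1)), (P c).coeff i = c i := fun c i => by
    simp only [P, finsetSum_coeff, coeff_C_mul_X_pow]
    rw [Finset.sum_eq_single i] <;> simp +contextual [Fin.ext_iff, eq_comm]
  have hcont : ∀ q : ℝ[X], Continuous fun c => L (q * (P c * P c)) := fun q => by
    have : ∀ c, L (q * (P c * P c)) =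
        ∑ i, ∑ j, c i * (c j * L (q * (X ^ (i : ℕ) * X ^ (j : ℕ)))) := fun c => by
      simp only [P]
      rw [Finset.sum_mul_sum]
      simp only [Finset.mul_sum, map_sum]
      refine Finset.sum_congr rfl fun i _ => Finset.sum_congr rfl fun j _ => ?_
      rw [← functional_C_mul, ← functional_C_mul]
      congr 1
      ring
    simp only [this]
    fun_prop
  have hpos : ∀ c : Fin (n + 1) → ℝ, c ≠ 0 → 0 < L (P c * P c) := fun c hc =>
    hL.mul_self_pos fun h => hc (funext fun i => by rw [← hcoeff c i, h]; simp)
  have hsph : ∀ c ∈ Metric.sphere (0 : Fin (n + 1) → ℝ) 1, c ≠ 0 := fun c hc =>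
    ne_zero_of_mem_unit_sphere ⟨c, hc⟩
  -- The quotient of the two forms is homogeneous of degree `0`, so its bound on the unit sphere of
  -- coefficients suffices.
  obtain ⟨K, hK⟩ := (isCompact_sphere (0 : Fin (n + 1) → ℝ) 1).bddAbove_image
    (f := fun c => L (r * (P c * P c)) / L (P c * P c)) ((hcont r).continuousOn.div
      (by simpa using (hcont 1).continuousOn) fun c hc => (hpos c (hsph c hc)).ne')
  refine ⟨K, fun p hp => ?_⟩
  let c : Fin (n + 1) → ℝ := fun i => p.coeff i
  have hPc : P c = p := by
    conv_rhs => rw [as_sum_range_C_mul_X_pow' p (Nat.lt_succ_of_le hp)]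
    exact Fin.sum_univ_eq_sum_range (fun i => C (p.coeff i) * X ^ i) (n + 1)
  by_cases hc : c = 0
  · have : p = 0 := by rw [← hPc, hc]; simp [P]
    simp [this]
  have hn : 0 < ‖c‖ := norm_pos_iff.2 hc
  have hPd : P (‖c‖⁻¹ • c) = C ‖c‖⁻¹ * p := by
    rw [← hPc]
    simp only [P, Finset.mul_sum, Pi.smul_apply, smul_eq_mul, C_mul, mul_assoc]
  have hd : ‖c‖⁻¹ • c ∈ Metric.sphere (0 : Fin (n + 1) → ℝ) 1 := by
    rw [mem_sphere_zero_iff_norm, norm_smul, norm_inv, norm_norm, inv_mul_cancel₀ hn.ne']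
  have h1 := hK (Set.mem_image_of_mem _ hd)
  simp only [hPd] at h1
  have e1 : C ‖c‖⁻¹ * p * (C ‖c‖⁻¹ * p) = C (‖c‖⁻¹ * ‖c‖⁻¹) * (p * p) := by rw [C_mul]; ring
  rw [e1, mul_left_comm, functional_C_mul, functional_C_mul,
    mul_div_mul_left _ _ (by positivity)] at h1
  rwa [div_le_iff₀ (hPc ▸ hpos c hc)] at h1

/-! ### Bounds uniform in `z` -/

section

variable {ξ : ℝ}

/-- At `ξ = 0` changing `z` is a mere translation. Since the weight lies between `1 - ξ` and `1`
times that at `ξ = 0`, estimates at `z = 0` become uniform in `z`. -/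
theorem momentFunctional_zero_comp (z : ℝ) (p : ℝ[X]) :
    momentFunctional 0 0 (p.comp (X - C z)) = momentFunctional 0 z p := by
  rw [momentFunctional_apply, momentFunctional_apply, ← integral_add_right_eq_self _ z]
  congr 1 with s
  simp [weight]

theorem momentFunctional_le (hξ0 : 0 < ξ) (z : ℝ) {p : ℝ[X]} (hp : ∀ x, 0 ≤ p.eval x) :
    momentFunctional ξ z p ≤ momentFunctional 0 z p := by
  refine integral_mono (integrable_eval_mul_weight p ξ z) (integrable_eval_mul_weight p 0 z)
    fun s => mul_le_mul_of_nonneg_left ?_ (hp s)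
  rw [weight, weight]
  refine mul_le_mul_of_nonneg_left ?_ (by positivity)
  split_ifs <;> linarith

theorem le_momentFunctional (hξ0 : 0 < ξ) (z : ℝ) {p : ℝ[X]} (hp : ∀ x, 0 ≤ p.eval x) :
    (1 - ξ) * momentFunctional 0 z p ≤ momentFunctional ξ z p := by
  rw [momentFunctional_apply, ← integral_const_mul]
  refine integral_mono ((integrable_eval_mul_weight p 0 z).const_mul _)
    (integrable_eval_mul_weight p ξ z) fun s => ?_
  have : (1 - ξ) * weight 0 z s ≤ weight ξ z s := by
    rw [weight, weight, mul_left_comm]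
    refine mul_le_mul_of_nonneg_left ?_ (by positivity)
    split_ifs <;> linarith
  calc (1 - ξ) * (p.eval s * weight 0 z s) = p.eval s * ((1 - ξ) * weight 0 z s) := by ring
    _ ≤ _ := mul_le_mul_of_nonneg_left this (hp s)

/-- The zeros of the orthogonal polynomials, shifted by `z`, are bounded uniformly in `z`. -/
theorem exists_zeros_bound (hξ0 : 0 < ξ) (hξ1 : ξ < 1) (n : ℕ) :
    ∃ K : ℝ, ∀ z y, (orthoPoly (momentFunctional ξ z) n).eval y = 0 → |y + z| ≤ K := by
  have h0 := positiveFunctional_momentFunctional (ξ := 0) one_pos 0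
  obtain ⟨K, hK⟩ := h0.exists_bound (1 + X ^ 2) n
  refine ⟨K / (1 - ξ), fun z y hy => ?_⟩
  have hL := positiveFunctional_momentFunctional hξ1 z
  have hQ := hL.isMonicOrthogonal n
  set L := momentFunctional ξ z
  set Q := orthoPoly L n
  -- Write `Q = (X - y) g`. As `L (Q g) = 0`, the number `y + z` is the mean of `X + z` for the
  -- weight `g²`; it is then estimated by `|t| ≤ 1 + t²`.
  obtain ⟨g, hg⟩ := dvd_iff_isRoot.2 hy
  have hg0 : g ≠ 0 := fun h => hQ.monic.ne_zero (by rw [hg, h, mul_zero])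
  have hgn : g.natDegree + 1 = n := by
    rw [← hQ.natDegree, hg, natDegree_mul (X_sub_C_ne_zero y) hg0, natDegree_X_sub_C, add_comm]
  have h1 : L (Q * g) = 0 := hQ.orthogonal g (by
    rw [degree_eq_natDegree hg0]; exact_mod_cast (by omega))
  have h2 : (y + z) * L (g * g) = L ((X + C z) * (g * g)) := by
    have : (X + C z) * (g * g) = Q * g + C (y + z) * (g * g) := by rw [hg, C_add]; ring
    rw [this, map_add, h1, functional_C_mul, zero_add]
  have hgg := hL.mul_self_pos hg0
  have hgx : ∀ x, 0 ≤ (g * g).eval x := fun x => by rw [eval_mul]; exact mul_self_nonneg _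
  have h3 : ∀ q : ℝ[X], (∀ x, 0 ≤ q.eval x) → 0 ≤ L q := fun q hq => by
    by_cases h : q = 0
    · simp [h]
    · exact (hL q h hq).le
  have h4 : |L ((X + C z) * (g * g))| ≤ L ((1 + (X + C z) ^ 2) * (g * g)) := by
    rw [abs_le]
    constructor
    · rw [← sub_nonneg, sub_neg_eq_add, ← map_add]
      refine h3 _ fun x => ?_
      rw [← add_mul, eval_mul]
      refine mul_nonneg ?_ (hgx x)
      simp only [eval_add, eval_pow, eval_X, eval_C, eval_one]
      nlinarith [sq_nonneg (x + z + 1)]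
    · rw [← sub_nonneg, ← map_sub]
      refine h3 _ fun x => ?_
      rw [← sub_mul, eval_mul]
      refine mul_nonneg ?_ (hgx x)
      simp only [eval_add, eval_sub, eval_pow, eval_X, eval_C, eval_one]
      nlinarith [sq_nonneg (x + z - 1)]
  have h5 : L ((1 + (X + C z) ^ 2) * (g * g)) ≤ K * momentFunctional 0 z (g * g) := by
    refine (momentFunctional_le hξ0 z fun x => ?_).trans ?_
    · rw [eval_mul]
      refine mul_nonneg ?_ (hgx x)
      simp only [eval_add, eval_pow, eval_one]
      positivity
    · have e : ((1 + (X + C z) ^ 2) * (g * g)).comp (X - C z) =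
          (1 + X ^ 2) * (g.comp (X - C z) * g.comp (X - C z)) := by simp
      rw [← momentFunctional_zero_comp z, ← momentFunctional_zero_comp z, e, mul_comp]
      exact hK (g.comp (X - C z)) (by rw [natDegree_comp, natDegree_X_sub_C]; omega)
  have h6 := le_momentFunctional hξ0 z hgx
  have hM : 0 < momentFunctional 0 z (g * g) :=
    (positiveFunctional_momentFunctional one_pos z).mul_self_pos hg0
  rw [le_div_iff₀ (by linarith)]
  have h7 : |y + z| * L (g * g) ≤ K * momentFunctional 0 z (g * g) := by
    rw [← abs_of_pos hgg, ← abs_mul, h2]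
    exact h4.trans h5
  have h8 := mul_le_mul_of_nonneg_left h6 (abs_nonneg (y + z))
  refine le_of_mul_le_mul_right ?_ hM
  linarith

/-- A translate of `Q_n` is a monic competitor in the minimum problem for `ξ = 0`, `z = 0`. -/
theorem exists_lower_bound_tau_succ_div_tau (hξ0 : 0 < ξ) (hξ1 : ξ < 1) (n : ℕ) :
    ∃ c > 0, ∀ z, c ≤ tau (n + 1) ξ z / tau n ξ z := by
  have h0 := positiveFunctional_momentFunctional (ξ := 0) one_pos 0
  have hQ0 := h0.isMonicOrthogonal n
  refine ⟨(1 - ξ) * momentFunctional 0 0 (orthoPoly (momentFunctional 0 0) n *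
    orthoPoly (momentFunctional 0 0) n), mul_pos (by linarith) (h0.mul_self_pos
      hQ0.monic.ne_zero), fun z => ?_⟩
  have hQ := (positiveFunctional_momentFunctional hξ1 z).isMonicOrthogonal n
  rw [tau_succ_div_tau hξ1]
  refine le_trans ?_ (le_momentFunctional hξ0 z fun x => by
    rw [eval_mul]; exact mul_self_nonneg _)
  rw [← momentFunctional_zero_comp z, mul_comp]
  refine mul_le_mul_of_nonneg_left (hQ0.sq_le_of_monic h0 (hQ.monic.comp_X_sub_C z) ?_)
    (by linarith)
  rw [natDegree_comp, natDegree_X_sub_C, mul_one, hQ.natDegree]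

theorem exists_bound_bigSigma (hξ0 : 0 < ξ) (hξ1 : ξ < 1) (n : ℕ) :
    ∃ K : ℝ, ∀ z, |bigSigma n ξ z| ≤ K := by
  obtain ⟨c, hc, hcz⟩ := exists_lower_bound_tau_succ_div_tau hξ0 hξ1 n
  obtain ⟨K, hK⟩ := exists_zeros_bound hξ0 hξ1 n
  -- The constant comes from `t^(2n) ≤ (2n)! exp t` with `t = |z| + |K|`, and from `|z| - z² ≤ 1`.
  refine ⟨(√Real.pi)⁻¹ * ξ * ((2 * n).factorial * Real.exp (|K| + 1)) / c, fun z => ?_⟩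
  have hL := positiveFunctional_momentFunctional hξ1 z
  obtain ⟨y, hy, hQ⟩ := (hL.isMonicOrthogonal n).exists_strictMono_zeros hL
  have h1 : |(orthoPoly (momentFunctional ξ z) n).eval 0| ≤ (|z| + |K|) ^ n := by
    have hb : ∀ i, |y i| ≤ |z| + |K| := fun i => by
      have h2 := hK z (y i) (by rw [hQ, Lagrange.eval_nodal_at_node (Finset.mem_univ i)])
      have h3 := abs_sub (y i + z) z
      rw [add_sub_cancel_right] at h3
      linarith [le_abs_self K]
    rw [hQ, Lagrange.eval_nodal, Finset.abs_prod]
    calc ∏ i, |0 - y i| ≤ ∏ _i : Fin n, (|z| + |K|) :=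
          Finset.prod_le_prod (fun _ _ => abs_nonneg _) fun i _ => by
            rw [zero_sub, abs_neg]; exact hb i
      _ = _ := by simp
  have h2 : Real.exp (-z ^ 2) * (orthoPoly (momentFunctional ξ z) n).eval 0 ^ 2 ≤
      (2 * n).factorial * Real.exp (|K| + 1) := by
    have hs : (orthoPoly (momentFunctional ξ z) n).eval 0 ^ 2 ≤ (|z| + |K|) ^ (2 * n) := by
      rw [← sq_abs, mul_comm 2, pow_mul]
      exact pow_le_pow_left₀ (abs_nonneg _) h1 2
    have hf := Real.pow_div_factorial_le_exp (|z| + |K|) (by positivity) (2 * n)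
    rw [div_le_iff₀ (by positivity)] at hf
    have he : Real.exp (-z ^ 2) * Real.exp (|z| + |K|) ≤ Real.exp (|K| + 1) := by
      rw [← Real.exp_add, Real.exp_le_exp]
      nlinarith [sq_abs z, sq_nonneg (|z| - 1), abs_nonneg z]
    calc _ ≤ Real.exp (-z ^ 2) * (Real.exp (|z| + |K|) * (2 * n).factorial) :=
          mul_le_mul_of_nonneg_left (hs.trans hf) (Real.exp_pos _).le
      _ = (2 * n).factorial * (Real.exp (-z ^ 2) * Real.exp (|z| + |K|)) := by ring
      _ ≤ _ := mul_le_mul_of_nonneg_left he (by positivity)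
  have h3 := hcz z
  rw [bigSigma_eq hξ1, jumpDensity, abs_of_nonneg
    (div_nonneg (by positivity) (hc.le.trans h3)), mul_assoc _ (Real.exp _)]
  gcongr

/-! ### Counting the crossings of the origin -/

/-- Each ordered zero crosses the origin at most once, from right to left. -/
theorem zero_neg_of_nonpos (hξ1 : ξ < 1) {n : ℕ} {z z' : ℝ} (hz : z < z') {y y' : Fin n → ℝ}
    (hy : StrictMono y) (hy' : StrictMono y')
    (hQ : orthoPoly (momentFunctional ξ z) n = Lagrange.nodal Finset.univ y)
    (hQ' : orthoPoly (momentFunctional ξ z') n = Lagrange.nodal Finset.univ y')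
    {i : Fin n} (hi : y i ≤ 0) : y' i < 0 := by
  by_contra! hi'
  have hL := positiveFunctional_momentFunctional hξ1 z
  have hL' := positiveFunctional_momentFunctional hξ1 z'
  -- Here `p` has degree `n - 1`, so both quadratures are exact on `X p²`. At `z` only the nodes `k
  -- ≤ i`, all nonpositive, survive; at `z'` only `k ≥ i`, all nonnegative. The resulting signs
  -- contradict `momentFunctional_X_mul_sq_neg`.
  set p : ℝ[X] := Lagrange.nodal (Finset.Ioi i) y * Lagrange.nodal (Finset.Iio i) y' with hp
  have hp0 : p ≠ 0 := mul_ne_zero Lagrange.nodal_ne_zero Lagrange.nodal_ne_zero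
  have hdeg : (X * (p * p)).degree < ((2 * n : ℕ) : WithBot ℕ) := by
    rw [degree_mul, degree_mul, hp, degree_mul, Lagrange.degree_nodal, Lagrange.degree_nodal,
      degree_X, Fin.card_Ioi, Fin.card_Iio]
    norm_cast
    omega
  have h1 : momentFunctional ξ z (X * (p * p)) ≤ 0 := by
    have := (hL.isMonicOrthogonal n).functional_nonneg_of_eval_nonneg hL hy.injective hQ
      (r := -(X * (p * p))) (by rwa [degree_neg]) fun k => ?_
    · rwa [map_neg, neg_nonneg] at this
    · rw [eval_neg, neg_nonneg, eval_mul, eval_mul, eval_X]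
      rcases le_or_gt k i with hk | hk
      · exact mul_nonpos_of_nonpos_of_nonneg ((hy.monotone hk).trans hi) (mul_self_nonneg _)
      · rw [hp, eval_mul, Lagrange.eval_nodal_at_node (Finset.mem_Ioi.2 hk)]
        simp
  have h2 : 0 ≤ momentFunctional ξ z' (X * (p * p)) := by
    refine (hL'.isMonicOrthogonal n).functional_nonneg_of_eval_nonneg hL' hy'.injective hQ' hdeg
      fun k => ?_
    rw [eval_mul, eval_mul, eval_X]
    rcases le_or_gt i k with hk | hk
    · exact mul_nonneg (hi'.trans (hy'.monotone hk)) (mul_self_nonneg _)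
    · rw [hp, eval_mul, Lagrange.eval_nodal_at_node (Finset.mem_Iio.2 hk)]
      simp
  exact (momentFunctional_X_mul_sq_neg hξ1 hz hp0 h1).not_ge h2

/-- The value at the origin of the orthogonal polynomial of degree `n` vanishes for exactly `n`
values of the parameter. -/
theorem encard_eval_orthoPoly_eq_zero (hξ0 : 0 < ξ) (hξ1 : ξ < 1) (n : ℕ) :
    {z : ℝ | (orthoPoly (momentFunctional ξ z) n).eval 0 = 0}.encard = (n : ℕ∞) := by
  choose y hy hQ using fun z =>
    ((positiveFunctional_momentFunctional hξ1 z).isMonicOrthogonal n).exists_strictMono_zeros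
      (positiveFunctional_momentFunctional hξ1 z)
  obtain ⟨K, hK⟩ := exists_zeros_bound hξ0 hξ1 n
  have hb : ∀ z i, |y z i + z| ≤ |K| := fun z i =>
    (hK z (y z i) (by rw [hQ, Lagrange.eval_nodal_at_node (Finset.mem_univ i)])).trans
      (le_abs_self K)
  have hex : ∀ i, ∃ z, y z i = 0 := fun i => by
    have hc := continuous_zeros (continuous_eval_orthoPoly hξ1 n) hy hQ i
    refine mem_range_of_exists_le_of_exists_ge hc ⟨|K|, ?_⟩ ⟨-|K|, ?_⟩
    · linarith [(abs_le.1 (hb |K| i)).2]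
    · linarith [(abs_le.1 (hb (-|K|) i)).1]
  choose ζ hζ using hex
  have huniq : ∀ i z, y z i = 0 → z = ζ i := fun i z hz => by
    rcases lt_trichotomy z (ζ i) with h | h | h
    · exact absurd (hζ i) (zero_neg_of_nonpos hξ1 h (hy _) (hy _) (hQ _) (hQ _) hz.le).ne
    · exact h
    · exact absurd hz (zero_neg_of_nonpos hξ1 h (hy _) (hy _) (hQ _) (hQ _) (hζ i).le).ne
  -- Two indices with a common crossing parameter would give a double zero at the origin.
  have hinj : Function.Injective ζ := fun i j hij =>
    (hy (ζ i)).injective (by rw [hζ i, hij, hζ j])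
  have hset : {z : ℝ | (orthoPoly (momentFunctional ξ z) n).eval 0 = 0} = Set.range ζ := by
    ext z
    rw [Set.mem_ofPred_eq, hQ, Lagrange.eval_nodal, Finset.prod_eq_zero_iff]
    constructor
    · rintro ⟨i, _, hi⟩
      exact ⟨i, (huniq i z (by linarith)).symm⟩
    · rintro ⟨i, rfl⟩
      exact ⟨i, Finset.mem_univ i, by rw [hζ, sub_zero]⟩
  rw [hset, ← Set.image_univ, hinj.encard_image, Set.encard_univ]
  simp

/-! ### Signs and bounds of `Σ_n` and `σ_n` -/

theorem jumpDensity_pos (hξ0 : 0 < ξ) (z : ℝ) : 0 < jumpDensity ξ z := by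
  rw [jumpDensity]; positivity

theorem bigSigma_nonneg (hξ0 : 0 < ξ) (hξ1 : ξ < 1) (n : ℕ) (z : ℝ) : 0 ≤ bigSigma n ξ z := by
  rw [bigSigma_eq hξ1]
  exact div_nonneg (mul_nonneg (jumpDensity_pos hξ0 z).le (sq_nonneg _))
    (div_pos (tau_pos hξ1 _ z) (tau_pos hξ1 _ z)).le

theorem bigSigma_eq_zero_iff (hξ0 : 0 < ξ) (hξ1 : ξ < 1) (n : ℕ) (z : ℝ) :
    bigSigma n ξ z = 0 ↔ (orthoPoly (momentFunctional ξ z) n).eval 0 = 0 := by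
  have h1 := (jumpDensity_pos hξ0 z).ne'
  have h2 := (div_pos (tau_pos hξ1 (n + 1) z) (tau_pos hξ1 n z)).ne'
  rw [bigSigma_eq hξ1, div_eq_zero_iff, or_iff_left h2, mul_eq_zero, or_iff_right h1,
    sq_eq_zero_iff]

/-- The term `Σ_0` is strictly positive because `Q_0 = 1` does not vanish at the origin. -/
theorem smallSigma_pos (hξ0 : 0 < ξ) (hξ1 : ξ < 1) {n : ℕ} (hn : 1 ≤ n) (z : ℝ) :
    0 < smallSigma n ξ z := by
  have h0 : 0 < bigSigma 0 ξ z := by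
    refine (bigSigma_nonneg hξ0 hξ1 0 z).lt_of_ne' fun h => ?_
    have h1 := ((positiveFunctional_momentFunctional hξ1 z).isMonicOrthogonal 0)
    rw [bigSigma_eq_zero_iff hξ0 hξ1, h1.monic.natDegree_eq_zero.1 h1.natDegree] at h
    simp at h
  rw [smallSigma_eq_sum hξ1]
  exact Finset.sum_pos' (fun k _ => bigSigma_nonneg hξ0 hξ1 k z)
    ⟨0, Finset.mem_range.2 hn, h0⟩

theorem exists_bound_smallSigma (hξ0 : 0 < ξ) (hξ1 : ξ < 1) (n : ℕ) :
    ∃ K : ℝ, ∀ z, |smallSigma n ξ z| ≤ K := by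
  choose K hK using exists_bound_bigSigma hξ0 hξ1
  refine ⟨∑ k ∈ Finset.range n, K k, fun z => ?_⟩
  rw [smallSigma_eq_sum hξ1]
  exact (Finset.abs_sum_le_sum_abs _ _).trans (Finset.sum_le_sum fun k _ => hK k z)

end

end BoundState

theorem mainTheorem7 (ξ : ℝ) (hξ0 : 0 < ξ) (hξ1 : ξ < 1) :
    (∀ n : ℕ, Differentiable ℝ (fun z : ℝ => BoundState.tau n ξ z) ∧
      ∀ z : ℝ, 0 < BoundState.tau n ξ z) ∧
    (∀ n : ℕ, (∀ z : ℝ, 0 ≤ BoundState.bigSigma n ξ z) ∧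
      {z : ℝ | BoundState.bigSigma n ξ z = 0}.encard = (n : ℕ∞) ∧
      ∃ C : ℝ, ∀ z : ℝ, |BoundState.bigSigma n ξ z| ≤ C) ∧
    (∀ n : ℕ, 1 ≤ n → (∀ z : ℝ, 0 < BoundState.smallSigma n ξ z) ∧
      ∃ C : ℝ, ∀ z : ℝ, |BoundState.smallSigma n ξ z| ≤ C) := by
  refine ⟨fun n => ⟨BoundState.differentiable_tau n ξ, BoundState.tau_pos hξ1 n⟩,
    fun n => ⟨BoundState.bigSigma_nonneg hξ0 hξ1 n, ?_,
      BoundState.exists_bound_bigSigma hξ0 hξ1 n⟩,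
    fun n hn => ⟨BoundState.smallSigma_pos hξ0 hξ1 hn,
      BoundState.exists_bound_smallSigma hξ0 hξ1 n⟩⟩
  simp only [BoundState.bigSigma_eq_zero_iff hξ0 hξ1]
  exact BoundState.encard_eval_orthoPoly_eq_zero hξ0 hξ1 n
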